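/- Let $R$ be a commutative Noetherian ring and let $I$ be an ideal of $R$ contained in the Jacobson radical $\operatorname{rad}(R)$. An $R$-module $M$ is called relatively-$I$-flat (resp. relatively-$I$-injective) if $\operatorname{Tor}_i^R(R/J,M)=0$ (resp. $\operatorname{Ext}^i_R(R/J,M)=0$) for all $i\geq 1$ and every ideal $J$ of $R$ that contains some power $I^t$ of $I$. The relatively-$I$-flat dimension $\operatorname{fd}^I_R M$ is the least $n\geq 0$ for which there is an exact sequence $0\to F_n\to\cdots\to F_0\to M\to 0$ with all $F_i$ relatively-$I$-flat, and $\infty$ if there is no such $n$; the relatively-$I$-injective dimension $\operatorname{id}^I_R M$ is defined dually, by exact sequences $0\to M\to E_0\to\cdots\to E_n\to 0$ with all $E_i$ relatively-$I$-injective. Write $\operatorname{fd}_R$, $\operatorname{id}_R$ for the usual flat and injective dimensions and $\operatorname{gl.dim} R$ for the global dimension, the supremum of the projective dimensions of all $R$-modules. (All dimensions of the zero module are $-\infty$ by convention.) Then: (1) for every finitely generated $R$-module $M$, $\operatorname{fd}^I_R M=\operatorname{fd}_R M$ and $\operatorname{id}^I_R M=\operatorname{id}_R M$; (2) $\operatorname{gl.dim}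 R=\sup\{\operatorname{fd}^I_R M\}=\sup\{\operatorname{id}^I_R M\}$, where both suprema run over all $R$-modules $M$. -/

import Mathlib

open CategoryTheory

universe u

/-- `M` is relatively-`I`-flat: `Tor_i(R/J, M) = 0` for all `i ≥ 1` and every ideal `J`
containing a power of `I`. -/
def IsRelFlat {R : Type u} [CommRing R] (I : Ideal R) (M : ModuleCat.{u} R) : Prop :=
  ∀ J : Ideal R, (∃ t : ℕ, I ^ t ≤ J) → ∀ i : ℕ, 1 ≤ i →
    Limits.IsZero (((Tor (ModuleCat.{u} R) i).obj (ModuleCat.of R (R ⧸ J))).obj M)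

/-- `M` is relatively-`I`-injective: `Ext^i(R/J, M) = 0` for all `i ≥ 1` and every ideal `J`
containing a power of `I`. -/
def IsRelInjective {R : Type u} [CommRing R] (I : Ideal R) (M : ModuleCat.{u} R) : Prop :=
  ∀ J : Ideal R, (∃ t : ℕ, I ^ t ≤ J) → ∀ i : ℕ, 1 ≤ i →
    Subsingleton (Abelian.Ext (ModuleCat.of R (R ⧸ J)) M i)

/-- There is an exact sequence `0 → F_n → ⋯ → F_1 → F_0 → M → 0` with all `F_i` in the class `P`.
The sequence is continued on the left by zero modules. -/
def HasResolutionLE {R : Type u} [CommRing R] (P : ModuleCat.{u} R → Prop)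
    (M : ModuleCat.{u} R) (n : ℕ) : Prop :=
  ∃ (F : ℕ → ModuleCat.{u} R) (d : ∀ i, F (i + 1) →ₗ[R] F i) (ε : F 0 →ₗ[R] M),
    (∀ i, i ≤ n → P (F i)) ∧ (∀ i, n < i → Subsingleton (F i)) ∧
    Function.Surjective ε ∧ Function.Exact (d 0) ε ∧ ∀ i, Function.Exact (d (i + 1)) (d i)

/-- There is an exact sequence `0 → M → E_0 → E_1 → ⋯ → E_n → 0` with all `E_i` in the class `P`.
The sequence is continued on the right by zero modules. -/
def HasCoresolutionLE {R : Type u} [CommRing R] (P : ModuleCat.{u} R → Prop)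
    (M : ModuleCat.{u} R) (n : ℕ) : Prop :=
  ∃ (E : ℕ → ModuleCat.{u} R) (d : ∀ i, E i →ₗ[R] E (i + 1)) (η : M →ₗ[R] E 0),
    (∀ i, i ≤ n → P (E i)) ∧ (∀ i, n < i → Subsingleton (E i)) ∧
    Function.Injective η ∧ Function.Exact η (d 0) ∧ ∀ i, Function.Exact (d i) (d (i + 1))

/-- The least `n` such that `M` has a resolution of length `n` by modules in `P`, and `⊤` if there
is no such `n`. As for Mathlib's `projectiveDimension` and `injectiveDimension`, the value at the
zero module is `⊥`. -/
noncomputable def resolutionDim {R : Type u} [CommRing R] (P : ModuleCat.{u} R → Prop)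
    (M : ModuleCat.{u} R) : WithBot ℕ∞ :=
  sInf {x | (x = ⊥ ∧ Subsingleton M) ∨ ∃ n : ℕ, x = n ∧ HasResolutionLE P M n}

/-- The least `n` such that `M` has a coresolution of length `n` by modules in `P`, and `⊤` if
there is no such `n`. As for Mathlib's `projectiveDimension` and `injectiveDimension`, the value
at the zero module is `⊥`. -/
noncomputable def coresolutionDim {R : Type u} [CommRing R] (P : ModuleCat.{u} R → Prop)
    (M : ModuleCat.{u} R) : WithBot ℕ∞ :=
  sInf {x | (x = ⊥ ∧ Subsingleton M) ∨ ∃ n : ℕ, x = n ∧ HasCoresolutionLE P M n}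

/-- The flat dimension. -/
noncomputable def flatDim {R : Type u} [CommRing R] (M : ModuleCat.{u} R) : WithBot ℕ∞ :=
  resolutionDim (fun F => Module.Flat R F) M

/-- The relatively-`I`-flat dimension. -/
noncomputable def relFlatDim {R : Type u} [CommRing R] (I : Ideal R) (M : ModuleCat.{u} R) :
    WithBot ℕ∞ :=
  resolutionDim (IsRelFlat I) M

/-- The relatively-`I`-injective dimension. -/
noncomputable def relInjectiveDim {R : Type u} [CommRing R] (I : Ideal R) (M : ModuleCat.{u} R) :
    WithBot ℕ∞ :=
  coresolutionDim (IsRelInjective I) M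

/-- The global dimension: the supremum of the projective dimensions of all modules. -/
noncomputable def globalDim (R : Type u) [CommRing R] : WithBot ℕ∞ :=
  ⨆ M : ModuleCat.{u} R, projectiveDimension M

/-! The Jacobson hypothesis puts `I` inside every maximal ideal `m`, so relative flatness or
injectivity controls Tor and Ext against every `R ⧸ m`. Over a Noetherian ring, vanishing against
these residue fields already bounds the ordinary dimensions of a finitely generated `M`.

Flat side: for finite `M` the cycle `relFlatDim ≤ flatDim ≤ projectiveDimension ≤ relFlatDim` closes
up. Only the last inequality has content (`hasProjectiveDimensionLE_of_torVanishes`). A relatively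
flat resolution of length `n` kills `Tor_{n+1}(R/m, M)`; shifting to a syzygy reduces to `Tor_1`.
Linear algebra over `R/m` turns `Tor_1(R/m, M) = 0` into `Ext^1(M, R/m) = 0`. Noetherian induction
extends this to `Ext^1(M, N) = 0` for all finite `N`, so a finite free cover of `M` splits.

Injective side: a relatively injective coresolution of length `n` kills `Ext^i(R/m, M)` for `i > n`.
Noetherian induction passes to every `R/J` (`subsingleton_ext_quotient_of_maximal`), and Baer's
criterion bounds the injective dimension.

Global dimension: it is the supremum of the projective dimensions, or of the injective dimensions,
of finite modules. There the relative dimensions agree with these, and on all modules they are at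
most `globalDim`. -/

section Splice

/-! ### Dimension shifting for left derived functors -/

variable {C : Type*} [Category* C] [Abelian C]

theorem CategoryTheory.ShortComplex.exact_comp_iff_mono {A B K P : C} {f : A ⟶ B} {g : B ⟶ K}
    (m : K ⟶ P) [Epi g] (w : f ≫ g = 0) (h : (ShortComplex.mk f g w).Exact)
    (w' : f ≫ g ≫ m = 0) : (ShortComplex.mk f (g ≫ m) w').Exact ↔ Mono m := by
  constructor
  · intro h'
    rw [Preadditive.mono_iff_cancel_zero]
    intro T z hz
    obtain ⟨T₁, π₁, _, b, hb⟩ := surjective_up_to_refinements_of_epi g z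
    obtain ⟨T₂, π₂, _, a, ha⟩ := h'.exact_up_to_refinements b (by
      dsimp; rw [← Category.assoc, ← hb, Category.assoc, hz, Limits.comp_zero])
    dsimp at ha
    rw [← cancel_epi π₁, ← cancel_epi π₂, hb, ← Category.assoc, ha, Category.assoc, w]
    simp
  · intro _
    let φ : ShortComplex.mk f g w ⟶ ShortComplex.mk f (g ≫ m) w' :=
      { τ₁ := 𝟙 _, τ₂ := 𝟙 _, τ₃ := m }
    have : Epi φ.τ₁ := inferInstanceAs (Epi (𝟙 _))
    have : IsIso φ.τ₂ := inferInstanceAs (IsIso (𝟙 _))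
    have : Mono φ.τ₃ := ‹Mono m›
    exact (ShortComplex.exact_iff_of_epi_of_isIso_of_mono φ).1 h

/-- The augmentation of a projective resolution. -/
noncomputable def CategoryTheory.ProjectiveResolution.augmentation {M : C}
    (Q : ProjectiveResolution M) : Q.complex.X 0 ⟶ M := Q.π.f 0

instance {M : C} (Q : ProjectiveResolution M) : Epi Q.augmentation :=
  inferInstanceAs (Epi (Q.π.f 0))

theorem CategoryTheory.ProjectiveResolution.d_comp_augmentation {M : C}
    (Q : ProjectiveResolution M) : Q.complex.d 1 0 ≫ Q.augmentation = 0 :=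
  Q.complex_d_comp_π_f_zero

theorem CategoryTheory.ProjectiveResolution.exact_augmentation {M : C}
    (Q : ProjectiveResolution M) : (ShortComplex.mk _ _ Q.d_comp_augmentation).Exact :=
  ShortComplex.exact_of_g_is_cokernel _ Q.isColimitCokernelCofork

/-- Splicing a projective resolution of `S.X₁` with a short exact sequence `S` whose middle term
is projective gives a projective resolution of `S.X₃`. -/
noncomputable def CategoryTheory.ProjectiveResolution.splice {S : ShortComplex C}
    (hS : S.ShortExact) [Projective S.X₂] (Q : ProjectiveResolution S.X₁) :
    ProjectiveResolution S.X₃ where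
  complex := ChainComplex.augment Q.complex (Q.augmentation ≫ S.f) (by
    rw [← Category.assoc, Q.d_comp_augmentation, Limits.zero_comp])
  projective n := by
    cases n
    · assumption
    · exact Q.projective _
  π := (ChainComplex.toSingle₀Equiv _ _).symm ⟨S.g, by
    have : (Q.augmentation ≫ S.f) ≫ S.g = 0 := by simp
    exact this⟩
  quasiIso := ⟨fun n => by
    cases n with
    | zero =>
      rw [ChainComplex.quasiIsoAt₀_iff, ShortComplex.quasiIso_iff_of_zeros']
      · have hg := ChainComplex.toSingle₀Equiv_symm_apply_f_zero (C := ChainComplex.augment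
          Q.complex (Q.augmentation ≫ S.f) (by
            rw [← Category.assoc, Q.d_comp_augmentation, Limits.zero_comp])) S.g (by
          have : (Q.augmentation ≫ S.f) ≫ S.g = 0 := by simp
          exact this)
        -- Precomposing `S.f` with an epimorphism does not change its image, so exactness is
        -- inherited from `S`.
        let φ : ShortComplex.mk (Q.augmentation ≫ S.f) S.g (by simp) ⟶ S :=
          { τ₁ := Q.augmentation, τ₂ := 𝟙 _, τ₃ := 𝟙 _ }
        have : Epi φ.τ₁ := inferInstanceAs (Epi Q.augmentation)
        have : IsIso φ.τ₂ := inferInstanceAs (IsIso (𝟙 _))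
        have : Mono φ.τ₃ := inferInstanceAs (Mono (𝟙 _))
        refine (ShortComplex.exact_and_epi_g_iff_of_iso ?_).2
          ⟨(ShortComplex.exact_iff_of_epi_of_isIso_of_mono φ).2 hS.exact, hS.epi_g⟩
        exact ShortComplex.isoMk (Iso.refl _) (Iso.refl _) (Iso.refl _)
          ((Category.id_comp _).trans (Category.comp_id _).symm)
          ((Category.id_comp _).trans (hg.symm.trans (Category.comp_id _).symm))
      all_goals rfl
    | succ n =>
      rw [quasiIsoAt_iff_exactAt']
      · cases n with
        | zero =>
          -- Degree 1 is the splice point: exactness there amounts to `S.f` being mono.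
          rw [HomologicalComplex.exactAt_iff' _ 2 1 0 (by simp) (by simp)]
          have := hS.mono_f
          exact (ShortComplex.exact_comp_iff_mono S.f Q.d_comp_augmentation
            Q.exact_augmentation _).2 this
        | succ n =>
          rw [HomologicalComplex.exactAt_iff' _ (n + 3) (n + 2) (n + 1) (by simp) (by simp)]
          exact Q.exact_succ n
      · apply ChainComplex.exactAt_succ_single_obj⟩

variable {D : Type*} [Category* D] [Abelian D] [HasProjectiveResolutions C]

theorem CategoryTheory.Functor.isZero_leftDerived_obj_iff_exact (F : C ⥤ D) [F.Additive] {M : C}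
    (P : ProjectiveResolution M) (n : ℕ) :
    Limits.IsZero ((F.leftDerived (n + 1)).obj M) ↔
      (ShortComplex.mk (F.map (P.complex.d (n + 2) (n + 1))) (F.map (P.complex.d (n + 1) n))
        (by rw [← F.map_comp, P.complex.d_comp_d, F.map_zero])).Exact := by
  rw [(P.isoLeftDerivedObj F (n + 1)).isZero_iff]
  erw [← HomologicalComplex.exactAt_iff_isZero_homology]
  rw [HomologicalComplex.exactAt_iff' _ (n + 2) (n + 1) n (by simp) (by simp)]
  rfl

/-- In positive degrees the spliced resolution is `Q` shifted by one, so both sides are the same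
exactness condition. -/
theorem CategoryTheory.ShortComplex.ShortExact.isZero_leftDerived_succ_iff {S : ShortComplex C}
    (hS : S.ShortExact) [Projective S.X₂] (F : C ⥤ D) [F.Additive] (n : ℕ) :
    Limits.IsZero ((F.leftDerived (n + 2)).obj S.X₃) ↔
      Limits.IsZero ((F.leftDerived (n + 1)).obj S.X₁) := by
  let Q := (HasProjectiveResolutions.out S.X₁).out.some
  rw [F.isZero_leftDerived_obj_iff_exact Q, F.isZero_leftDerived_obj_iff_exact (Q.splice hS)]
  rfl

/-- Right exactness keeps `F(Q₁) ⟶ F(Q₀) ⟶ F(S.X₁)` exact with an epi at the end;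
`exact_comp_iff_mono` then reads off degree 1 of the spliced resolution. -/
theorem CategoryTheory.ShortComplex.ShortExact.isZero_leftDerived_one_iff {S : ShortComplex C}
    (hS : S.ShortExact) [Projective S.X₂] (F : C ⥤ D) [F.Additive]
    [Limits.PreservesFiniteColimits F] :
    Limits.IsZero ((F.leftDerived 1).obj S.X₃) ↔ Mono (F.map S.f) := by
  let Q := (HasProjectiveResolutions.out S.X₁).out.some
  rw [F.isZero_leftDerived_obj_iff_exact (Q.splice hS)]
  have h := Q.exact_augmentation.map_of_epi_of_preservesCokernel F (by dsimp; infer_instance)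
    inferInstance
  have hw : F.map (Q.complex.d 1 0) ≫ F.map Q.augmentation ≫ F.map S.f = 0 := by
    rw [← F.map_comp, ← F.map_comp, ← Category.assoc, Q.d_comp_augmentation, Limits.zero_comp,
      F.map_zero]
  rw [← ShortComplex.exact_comp_iff_mono (F.map S.f) _ h hw]
  simp only [← F.map_comp]
  rfl

end Splice

/-! ### Tor of modules computed from projective covers -/

namespace ModuleCat

open TensorProduct

variable {R : Type u} [CommRing R] (X : Type u) [AddCommGroup X] [Module R X]
  {K P M : Type u} [AddCommGroup K] [Module R K] [AddCommGroup P] [Module R P]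
  [AddCommGroup M] [Module R M] {f : K →ₗ[R] P} {g : P →ₗ[R] M}

/-- `Tor_i(X, M) = 0`. -/
abbrev TorVanishes (R : Type u) [CommRing R] (X M : Type u) [AddCommGroup X] [Module R X]
    [AddCommGroup M] [Module R M] (i : ℕ) : Prop :=
  Limits.IsZero (((Tor (ModuleCat.{u} R) i).obj (ModuleCat.of R X)).obj (ModuleCat.of R M))

theorem shortExact_of_exact (hf : Function.Injective f) (hfg : Function.Exact f g)
    (hg : Function.Surjective g) :
    (ShortComplex.mk (ofHom f) (ofHom g) (by ext x; exact hfg.apply_apply_eq_zero x)).ShortExact :=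
  have := (ModuleCat.mono_iff_injective (ofHom f)).2 hf
  have := (ModuleCat.epi_iff_surjective (ofHom g)).2 hg
  { exact := (ShortComplex.ShortExact.moduleCat_exact_iff_function_exact _).2 hfg }

theorem torVanishes_succ_iff (hf : Function.Injective f) (hfg : Function.Exact f g)
    (hg : Function.Surjective g) [Module.Projective R P] (i : ℕ) :
    TorVanishes R X M (i + 2) ↔ TorVanishes R X K (i + 1) := by
  have : Projective (of R P) := (IsProjective.iff_projective (R := R) P).1 inferInstance
  exact @ShortComplex.ShortExact.isZero_leftDerived_succ_iff _ _ _ _ _ _ _ _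
    (shortExact_of_exact hf hfg hg) this _ _ i

theorem torVanishes_one_iff (hf : Function.Injective f) (hfg : Function.Exact f g)
    (hg : Function.Surjective g) [Module.Projective R P] :
    TorVanishes R X M 1 ↔ Function.Injective (f.lTensor X) := by
  have : Projective (of R P) := (IsProjective.iff_projective (R := R) P).1 inferInstance
  have : Limits.PreservesFiniteColimits
      ((MonoidalCategory.tensoringLeft (ModuleCat.{u} R)).obj (of R X)) :=
    inferInstanceAs (Limits.PreservesFiniteColimits (MonoidalCategory.tensorLeft (of R X)))
  refine (@ShortComplex.ShortExact.isZero_leftDerived_one_iff _ _ _ _ _ _ _ _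
    (shortExact_of_exact hf hfg hg) ‹_› ((MonoidalCategory.tensoringLeft _).obj (of R X)) _ _).trans
    ?_
  rw [ModuleCat.mono_iff_injective]
  rfl

theorem torVanishes_succ_iff_ker (hg : Function.Surjective g) [Module.Projective R P] (i : ℕ) :
    TorVanishes R X M (i + 2) ↔ TorVanishes R X (LinearMap.ker g) (i + 1) :=
  torVanishes_succ_iff (K := LinearMap.ker g) X (LinearMap.ker g).subtype_injective
    (LinearMap.exact_subtype_ker_map g) hg i

theorem torVanishes_one_iff_ker (hg : Function.Surjective g) [Module.Projective R P] :
    TorVanishes R X M 1 ↔ Function.Injective ((LinearMap.ker g).subtype.lTensor X) :=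
  torVanishes_one_iff (K := LinearMap.ker g) X (LinearMap.ker g).subtype_injective
    (LinearMap.exact_subtype_ker_map g) hg

end ModuleCat

/-! ### Tor along short exact sequences, and Tor of flat modules -/

namespace ModuleCat

open TensorProduct

variable {R : Type u} [CommRing R] (X : Type u) [AddCommGroup X] [Module R X]

theorem TorVanishes.of_equiv {X M M' : Type u} [AddCommGroup X] [Module R X] [AddCommGroup M]
    [Module R M] [AddCommGroup M'] [Module R M'] (e : M ≃ₗ[R] M') {i : ℕ}
    (h : TorVanishes R X M i) : TorVanishes R X M' i :=
  h.of_iso (((Tor (ModuleCat.{u} R) i).obj (ModuleCat.of R X)).mapIso e.symm.toModuleIso)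

section

variable {A B C : Type u} [AddCommGroup A] [Module R A] [AddCommGroup B] [Module R B]
  [AddCommGroup C] [Module R C] {f : A →ₗ[R] B} {g : B →ₗ[R] C}

theorem exists_comp_eq_of_exact {N : Type u} [AddCommGroup N] [Module R N]
    (hf : Function.Injective f) (hfg : Function.Exact f g) (φ : N →ₗ[R] B) (h : g ∘ₗ φ = 0) :
    ∃ r : N →ₗ[R] A, f ∘ₗ r = φ := by
  have hr (x : N) : φ x ∈ LinearMap.range f := (hfg (φ x)).1 (LinearMap.congr_fun h x)
  refine ⟨(LinearEquiv.ofInjective f hf).symm.toLinearMap ∘ₗ φ.codRestrict _ hr, ?_⟩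
  ext x
  have := (LinearEquiv.ofInjective f hf).apply_symm_apply (φ.codRestrict _ hr x)
  exact congrArg Subtype.val this

theorem lTensor_injective_of_comp_eq {KB KC P : Type u} [AddCommGroup KB] [Module R KB]
    [AddCommGroup KC] [Module R KC] [AddCommGroup P] [Module R P] {j : KB →ₗ[R] KC}
    {r : KC →ₗ[R] A} {iB : KB →ₗ[R] P} {iC : KC →ₗ[R] P} {p : P →ₗ[R] B} (hj : iC ∘ₗ j = iB)
    (hr : f ∘ₗ r = p ∘ₗ iC) (hjr : Function.Exact j r) (hrs : Function.Surjective r)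
    (hX : Function.Injective (f.lTensor X)) (hB : Function.Injective (iB.lTensor X)) :
    Function.Injective (iC.lTensor X) := by
  rw [injective_iff_map_eq_zero]
  intro z hz
  have h1 : r.lTensor X z = 0 := by
    apply hX
    rw [map_zero, ← LinearMap.comp_apply, ← LinearMap.lTensor_comp, hr, LinearMap.lTensor_comp,
      LinearMap.comp_apply, hz, map_zero]
  obtain ⟨w, rfl⟩ := (lTensor_exact X hjr hrs z).1 h1
  have h2 : w = 0 := by
    apply hB
    rw [map_zero, ← hz, ← LinearMap.comp_apply, ← LinearMap.lTensor_comp, hj]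
  rw [h2, map_zero]

theorem torVanishes_one_of_exact (hf : Function.Injective f) (hfg : Function.Exact f g)
    (hg : Function.Surjective g) (hX : Function.Injective (f.lTensor X))
    (hB : TorVanishes R X B 1) : TorVanishes R X C 1 := by
  let p : (B →₀ R) →ₗ[R] B := Finsupp.linearCombination R id
  have hp : Function.Surjective p := Finsupp.linearCombination_id_surjective R B
  let q := g ∘ₗ p
  -- One free module covers both `B` and `C`; its two kernels fit into `0 → ker p → ker q → A → 0`.
  obtain ⟨r, hr⟩ := exists_comp_eq_of_exact (N := LinearMap.ker q) hf hfg (p ∘ₗ (LinearMap.ker q).subtype) (by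
    ext x; exact x.2)
  have hr' (x : LinearMap.ker q) : f (r x) = p x := LinearMap.congr_fun hr x
  have hle : LinearMap.ker p ≤ LinearMap.ker q := LinearMap.ker_le_ker_comp p g
  let j := Submodule.inclusion hle
  have hjr : Function.Exact j r := by
    intro x
    constructor
    · intro hx
      exact ⟨⟨x, by rw [LinearMap.mem_ker, ← hr', hx, map_zero]⟩, rfl⟩
    · rintro ⟨y, rfl⟩
      exact hf (by rw [hr', map_zero]; exact y.2)
  have hrs : Function.Surjective r := by
    intro a
    obtain ⟨b, hb⟩ := hp (f a)
    have hbq : b ∈ LinearMap.ker q := by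
      simp [q, hb, hfg.apply_apply_eq_zero]
    exact ⟨⟨b, hbq⟩, hf (by rw [hr', hb])⟩
  have hq : Function.Surjective q := hg.comp hp
  exact (torVanishes_one_iff_ker X hq).2 (lTensor_injective_of_comp_eq (KB := LinearMap.ker p)
    (KC := LinearMap.ker q) X rfl hr hjr hrs hX ((torVanishes_one_iff_ker X hp).1 hB))

/-- Horseshoe argument: free covers of `A` and `C` combine to one of `B`, and the kernels again form
a short exact sequence with Tor-acyclic middle term. Passing to kernels lowers both Tor degrees by
one. -/
theorem torVanishes_succ_of_exact (hf : Function.Injective f) (hfg : Function.Exact f g)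
    (hg : Function.Surjective g) (hB : ∀ i, TorVanishes R X B (i + 1)) {i : ℕ}
    (hA : TorVanishes R X A (i + 1)) : TorVanishes R X C (i + 2) := by
  induction i using Nat.strong_induction_on generalizing A B C with
  | _ i ih =>
  let a : (A →₀ R) →ₗ[R] A := Finsupp.linearCombination R id
  have ha : Function.Surjective a := Finsupp.linearCombination_id_surjective R A
  let c : (C →₀ R) →ₗ[R] C := Finsupp.linearCombination R id
  have hc : Function.Surjective c := Finsupp.linearCombination_id_surjective R C
  obtain ⟨s, hs⟩ := Module.projective_lifting_property g c hg
  have hs' (y) : g (s y) = c y := LinearMap.congr_fun hs y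
  let b : (A →₀ R) × (C →₀ R) →ₗ[R] B := (f ∘ₗ a).coprod s
  have hb' (x) : b x = f (a x.1) + s x.2 := rfl
  have hb : Function.Surjective b := by
    intro y
    obtain ⟨z, hz⟩ := hc (g y)
    obtain ⟨w, hw⟩ := (hfg (y - s z)).1 (by rw [map_sub, hs', hz, sub_self])
    obtain ⟨v, rfl⟩ := ha w
    exact ⟨(v, z), by rw [hb', hw]; simp⟩
  let j : LinearMap.ker a →ₗ[R] LinearMap.ker b :=
    (LinearMap.inl R _ _).restrict (fun x hx => by
      simp only [LinearMap.mem_ker] at hx ⊢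
      simp [hb', hx])
  have hj (x) : (j x : (A →₀ R) × (C →₀ R)) = (x.1, 0) := rfl
  let r : LinearMap.ker b →ₗ[R] LinearMap.ker c :=
    (LinearMap.snd R _ _).restrict (fun x hx => by
      rw [LinearMap.mem_ker, hb'] at hx
      have := congrArg g hx
      simpa [hs', hfg.apply_apply_eq_zero] using this)
  have hr (x) : (r x : C →₀ R) = x.1.2 := rfl
  have hji : Function.Injective j := by
    intro x y h
    have := congrArg Subtype.val h
    rw [hj, hj, Prod.mk.injEq] at this
    exact Subtype.ext this.1
  have hjr : Function.Exact j r := by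
    intro x
    constructor
    · intro hx
      have h2 : x.1.2 = 0 := congrArg Subtype.val hx
      have h1 : b x.1 = 0 := x.2
      rw [hb', h2, map_zero, add_zero] at h1
      refine ⟨⟨x.1.1, hf (by rw [h1, map_zero])⟩, Subtype.ext (Prod.ext rfl h2.symm)⟩
    · rintro ⟨y, rfl⟩
      rfl
  have hrs : Function.Surjective r := by
    intro z
    obtain ⟨w, hw⟩ := (hfg (s z)).1 (by rw [hs']; exact z.2)
    obtain ⟨v, rfl⟩ := ha w
    exact ⟨⟨(-v, z), by simp [hb', hw]⟩, rfl⟩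
  have hAi := torVanishes_succ_iff_ker X ha
  have hBi := torVanishes_succ_iff_ker X hb
  rw [torVanishes_succ_iff_ker X hc]
  have hKB (k : ℕ) : TorVanishes R X (LinearMap.ker b) (k + 1) := (hBi k).1 (hB _)
  cases i with
  | zero =>
    refine torVanishes_one_of_exact (A := LinearMap.ker a) (B := LinearMap.ker b)
      (C := LinearMap.ker c) X hji hjr hrs ?_ (hKB 0)
    rw [torVanishes_one_iff_ker X ha] at hA
    -- `ker a → A →₀ R` factors through `j`, so injectivity after tensoring passes to `j`.
    have h1 : (LinearMap.ker b).subtype ∘ₗ j = LinearMap.inl R _ _ ∘ₗ (LinearMap.ker a).subtype :=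
      rfl
    have h2 : LinearMap.fst R (A →₀ R) (C →₀ R) ∘ₗ (LinearMap.ker b).subtype ∘ₗ j =
        (LinearMap.ker a).subtype := rfl
    rw [← h2, ← LinearMap.comp_assoc, LinearMap.lTensor_comp, LinearMap.coe_comp] at hA
    exact hA.of_comp
  | succ i =>
    have := @ih i (Nat.lt_succ_self i) (LinearMap.ker a) (LinearMap.ker b) (LinearMap.ker c)
      _ _ _ _ _ _ j r
    exact this hji hjr hrs hKB ((hAi i).1 hA)

end

section Flat

variable {K P F : Type u} [AddCommGroup K] [Module R K] [AddCommGroup P] [Module R P]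
  [AddCommGroup F] [Module R F] {f : K →ₗ[R] P} {g : P →ₗ[R] F}

/-- Tor is balanced in degree 1: a diagram chase with a free cover of `X` trades injectivity for
that of `ker p ⊗ F → (X →₀ R) ⊗ F`, where flatness of `F` applies. -/
theorem lTensor_injective_of_exact_of_flat [Module.Flat R F] (hf : Function.Injective f)
    (hfg : Function.Exact f g) (hg : Function.Surjective g) : Function.Injective (f.lTensor X) := by
  let p : (X →₀ R) →ₗ[R] X := Finsupp.linearCombination R id
  have hp : Function.Surjective p := Finsupp.linearCombination_id_surjective R X
  exact lTensor_injective_of_exact_of_exact_of_rTensor_injective (M₁ := LinearMap.ker p)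
    (LinearMap.exact_subtype_ker_map p) hp hfg hg
    (Module.Flat.rTensor_preserves_injective_linearMap (M := F) (LinearMap.ker p).subtype
      (LinearMap.ker p).subtype_injective)
    (Module.Flat.lTensor_preserves_injective_linearMap _ hf)

theorem flat_of_exact_of_flat [Module.Flat R F] [Module.Flat R P] (hf : Function.Injective f)
    (hfg : Function.Exact f g) (hg : Function.Surjective g) : Module.Flat R K := by
  rw [Module.Flat.iff_rTensor_preserves_injective_linearMap]
  intro N N' _ _ _ _ h hh
  have h1 : Function.Injective (h.rTensor P ∘ₗ f.lTensor N) :=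
    (Module.Flat.rTensor_preserves_injective_linearMap h hh).comp
      (lTensor_injective_of_exact_of_flat N hf hfg hg)
  rw [LinearMap.rTensor_comp_lTensor, ← LinearMap.lTensor_comp_rTensor, LinearMap.coe_comp] at h1
  exact h1.of_comp

theorem TorVanishes.of_flat (F : Type u) [AddCommGroup F] [Module R F] [Module.Flat R F] (i : ℕ) :
    TorVanishes R X F (i + 1) := by
  induction i generalizing F with
  | zero =>
    let p : (F →₀ R) →ₗ[R] F := Finsupp.linearCombination R id
    have hp : Function.Surjective p := Finsupp.linearCombination_id_surjective R F
    exact (torVanishes_one_iff_ker X hp).2 (lTensor_injective_of_exact_of_flat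
      (K := LinearMap.ker p) X (LinearMap.ker p).subtype_injective
      (LinearMap.exact_subtype_ker_map p) hp)
  | succ i ih =>
    let p : (F →₀ R) →ₗ[R] F := Finsupp.linearCombination R id
    have hp : Function.Surjective p := Finsupp.linearCombination_id_surjective R F
    have : Module.Flat R (LinearMap.ker p) := flat_of_exact_of_flat (K := LinearMap.ker p)
      (LinearMap.ker p).subtype_injective (LinearMap.exact_subtype_ker_map p) hp
    exact (torVanishes_succ_iff_ker X hp i).2 (ih (LinearMap.ker p))

end Flat

end ModuleCat

/-! ### Order lemmas for dimensions valued in `WithBot ℕ∞` -/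

section WithBotENat

theorem WithBot.le_of_forall_natCast {a b : WithBot ℕ∞} (hbot : b = ⊥ → a = ⊥)
    (h : ∀ n : ℕ, b ≤ n → a ≤ n) : a ≤ b := by
  induction b with
  | bot => exact (hbot rfl).le
  | coe b =>
    induction b with
    | top => exact le_top
    | coe n => exact h n le_rfl

theorem WithBot.sInf_le_natCast_iff (p : Prop) (q : ℕ → Prop) (n : ℕ) :
    sInf {x : WithBot ℕ∞ | (x = ⊥ ∧ p) ∨ ∃ k : ℕ, x = k ∧ q k} ≤ n ↔ p ∨ ∃ k ≤ n, q k := by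
  constructor
  · intro h
    have hne : {x : WithBot ℕ∞ | (x = ⊥ ∧ p) ∨ ∃ k : ℕ, x = k ∧ q k}.Nonempty := by
      by_contra hs
      rw [Set.not_nonempty_iff_eq_empty.1 hs, sInf_empty, top_le_iff] at h
      exact ENat.natCast_ne_top n (WithBot.coe_injective h)
    obtain ⟨-, hp⟩ | ⟨k, hk, hq⟩ := csInf_mem hne
    · exact Or.inl hp
    · rw [hk] at h
      exact Or.inr ⟨k, by exact_mod_cast h, hq⟩
  · rintro (hp | ⟨k, hk, hq⟩)
    · exact sInf_le_of_le (b := ⊥) (Or.inl ⟨rfl, hp⟩) bot_le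
    · exact sInf_le_of_le (b := k) (Or.inr ⟨k, rfl, hq⟩) (by exact_mod_cast hk)

theorem WithBot.sInf_eq_bot_iff (p : Prop) (q : ℕ → Prop) :
    sInf {x : WithBot ℕ∞ | (x = ⊥ ∧ p) ∨ ∃ k : ℕ, x = k ∧ q k} = ⊥ ↔ p := by
  constructor
  · intro h
    have hne : {x : WithBot ℕ∞ | (x = ⊥ ∧ p) ∨ ∃ k : ℕ, x = k ∧ q k}.Nonempty := by
      by_contra hs
      rw [Set.not_nonempty_iff_eq_empty.1 hs, sInf_empty] at h
      exact absurd h (by simp)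
    obtain ⟨-, hp⟩ | ⟨k, hk, hq⟩ := csInf_mem hne
    · exact hp
    · rw [hk] at h
      exact absurd h (by exact WithBot.coe_ne_bot)
  · intro hp
    exact le_bot_iff.1 (sInf_le (Or.inl ⟨rfl, hp⟩))

end WithBotENat

/-! ### Building and truncating resolutions -/

section Resolution

variable {R : Type u} [CommRing R] {P Q : ModuleCat.{u} R → Prop} {M : ModuleCat.{u} R} {n : ℕ}

theorem resolutionDim_le_iff :
    resolutionDim P M ≤ n ↔ Subsingleton M ∨ ∃ k ≤ n, HasResolutionLE P M k :=
  WithBot.sInf_le_natCast_iff _ _ n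

theorem resolutionDim_eq_bot_iff : resolutionDim P M = ⊥ ↔ Subsingleton M :=
  WithBot.sInf_eq_bot_iff _ _

theorem coresolutionDim_le_iff :
    coresolutionDim P M ≤ n ↔ Subsingleton M ∨ ∃ k ≤ n, HasCoresolutionLE P M k :=
  WithBot.sInf_le_natCast_iff _ _ n

theorem coresolutionDim_eq_bot_iff : coresolutionDim P M = ⊥ ↔ Subsingleton M :=
  WithBot.sInf_eq_bot_iff _ _

theorem HasResolutionLE.mono (h : HasResolutionLE P M n) (hPQ : ∀ N, P N → Q N) :
    HasResolutionLE Q M n := by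
  obtain ⟨F, d, ε, hF, h⟩ := h
  exact ⟨F, d, ε, fun i hi => hPQ _ (hF i hi), h⟩

theorem HasCoresolutionLE.mono (h : HasCoresolutionLE P M n) (hPQ : ∀ N, P N → Q N) :
    HasCoresolutionLE Q M n := by
  obtain ⟨E, d, η, hE, h⟩ := h
  exact ⟨E, d, η, fun i hi => hPQ _ (hE i hi), h⟩

theorem HasResolutionLE.of_mem (h : P M) : HasResolutionLE P M 0 := by
  refine ⟨fun i => Nat.casesOn i M fun _ => ModuleCat.of R PUnit, fun _ => 0, LinearMap.id, ?_, ?_,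
    Function.surjective_id, ?_, ?_⟩
  · intro i hi
    obtain rfl : i = 0 := by omega
    exact h
  · intro i hi
    obtain ⟨i, rfl⟩ := Nat.exists_eq_succ_of_ne_zero hi.ne'
    exact inferInstanceAs (Subsingleton PUnit)
  · exact fun x => ⟨fun hx => ⟨0, hx.symm⟩, by rintro ⟨y, rfl⟩; rfl⟩
  · exact fun i x => ⟨fun _ => ⟨0, Subsingleton.elim (α := PUnit) _ _⟩, fun _ => rfl⟩

theorem HasCoresolutionLE.of_mem (h : P M) : HasCoresolutionLE P M 0 := by
  refine ⟨fun i => Nat.casesOn i M fun _ => ModuleCat.of R PUnit, fun _ => 0, LinearMap.id, ?_, ?_,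
    Function.injective_id, ?_, ?_⟩
  · intro i hi
    obtain rfl : i = 0 := by omega
    exact h
  · intro i hi
    obtain ⟨i, rfl⟩ := Nat.exists_eq_succ_of_ne_zero hi.ne'
    exact inferInstanceAs (Subsingleton PUnit)
  · exact fun x => ⟨fun _ => ⟨x, rfl⟩, fun _ => rfl⟩
  · exact fun i x => ⟨fun _ => ⟨0, Subsingleton.elim (α := PUnit) _ _⟩, fun _ => rfl⟩

theorem HasResolutionLE.succ {K N : ModuleCat.{u} R} {f : K →ₗ[R] N} {g : N →ₗ[R] M} (hN : P N)
    (hf : Function.Injective f) (hfg : Function.Exact f g) (hg : Function.Surjective g)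
    (h : HasResolutionLE P K n) : HasResolutionLE P M (n + 1) := by
  obtain ⟨F, d, ε, hF, hF', hε, hdε, hd⟩ := h
  refine ⟨fun i => Nat.casesOn i N F, fun i => Nat.casesOn i (f ∘ₗ ε) d, g, ?_, ?_, hg, ?_, ?_⟩
  · rintro (_ | i) hi
    · exact hN
    · exact hF i (by omega)
  · rintro (_ | i) hi
    · omega
    · exact hF' i (by omega)
  · intro x
    refine (hfg x).trans ⟨?_, ?_⟩
    · rintro ⟨y, rfl⟩
      obtain ⟨z, rfl⟩ := hε y
      exact ⟨z, rfl⟩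
    · rintro ⟨z, rfl⟩
      exact ⟨ε z, rfl⟩
  · rintro (_ | i)
    · intro x
      refine Iff.trans ?_ (hdε x)
      exact map_eq_zero_iff f hf
    · exact hd i

theorem HasCoresolutionLE.succ {N C : ModuleCat.{u} R} {f : M →ₗ[R] N} {g : N →ₗ[R] C} (hN : P N)
    (hf : Function.Injective f) (hfg : Function.Exact f g) (hg : Function.Surjective g)
    (h : HasCoresolutionLE P C n) : HasCoresolutionLE P M (n + 1) := by
  obtain ⟨E, d, η, hE, hE', hη, hηd, hd⟩ := h
  refine ⟨fun i => Nat.casesOn i N E, fun i => Nat.casesOn i (η ∘ₗ g) d, f, ?_, ?_, hf, ?_, ?_⟩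
  · rintro (_ | i) hi
    · exact hN
    · exact hE i (by omega)
  · rintro (_ | i) hi
    · omega
    · exact hE' i (by omega)
  · intro x
    refine Iff.trans ?_ (hfg x)
    exact map_eq_zero_iff η hη
  · rintro (_ | i)
    · intro x
      refine (hηd x).trans ⟨?_, ?_⟩
      · rintro ⟨y, rfl⟩
        obtain ⟨z, rfl⟩ := hg y
        exact ⟨z, rfl⟩
      · rintro ⟨z, rfl⟩
        exact ⟨g z, rfl⟩
    · exact hd i

/-- `P` need not be closed under isomorphism, hence the auxiliary `N`. -/
theorem HasResolutionLE.exists_equiv (h : HasResolutionLE P M 0) :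
    ∃ N, P N ∧ Nonempty (N ≃ₗ[R] M) := by
  obtain ⟨F, d, ε, hF, hF', hε, hdε, hd⟩ := h
  refine ⟨F 0, hF 0 le_rfl, ⟨LinearEquiv.ofBijective ε ⟨?_, hε⟩⟩⟩
  rw [injective_iff_map_eq_zero]
  intro x hx
  obtain ⟨y, rfl⟩ := (hdε x).1 hx
  have := hF' 1 Nat.zero_lt_one
  rw [Subsingleton.elim y 0, map_zero]

theorem HasCoresolutionLE.exists_equiv (h : HasCoresolutionLE P M 0) :
    ∃ N, P N ∧ Nonempty (M ≃ₗ[R] N) := by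
  obtain ⟨E, d, η, hE, hE', hη, hηd, hd⟩ := h
  refine ⟨E 0, hE 0 le_rfl, ⟨LinearEquiv.ofBijective η ⟨hη, fun x => ?_⟩⟩⟩
  have := hE' 1 Nat.zero_lt_one
  exact (hηd x).1 (Subsingleton.elim _ _)

theorem HasResolutionLE.exists_shortExact (h : HasResolutionLE P M (n + 1)) :
    ∃ S : ShortComplex (ModuleCat.{u} R), S.ShortExact ∧ S.X₃ = M ∧ P S.X₂ ∧
      HasResolutionLE P S.X₁ n := by
  obtain ⟨F, d, ε, hF, hF', hε, hdε, hd⟩ := h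
  refine ⟨_, LinearMap.shortExact_shortComplexKer hε, rfl, hF 0 (Nat.zero_le _),
    fun i => F (i + 1), fun i => d (i + 1),
    (d 0).codRestrict (LinearMap.ker ε) hdε.apply_apply_eq_zero, fun i hi => hF _ (by omega),
    fun i hi => hF' _ (by omega), ?_, ?_, fun i => hd _⟩
  · intro x
    obtain ⟨y, hy⟩ := (hdε x.1).1 x.2
    exact ⟨y, Subtype.ext hy⟩
  · intro x
    refine Iff.trans ?_ (hd 0 x)
    exact Subtype.ext_iff

theorem HasCoresolutionLE.exists_shortExact (h : HasCoresolutionLE P M (n + 1)) :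
    ∃ S : ShortComplex (ModuleCat.{u} R), S.ShortExact ∧ S.X₁ = M ∧ P S.X₂ ∧
      HasCoresolutionLE P S.X₃ n := by
  obtain ⟨E, d, η, hE, hE', hη, hηd, hd⟩ := h
  refine ⟨_, ModuleCat.shortExact_of_exact hη (LinearMap.exact_map_mkQ_range η)
    (Submodule.mkQ_surjective _), rfl, hE 0 (Nat.zero_le _),
    fun i => E (i + 1), fun i => d (i + 1),
    (LinearMap.range η).liftQ (d 0) (by rintro _ ⟨y, rfl⟩; exact hηd.apply_apply_eq_zero y),
    fun i hi => hE _ (by omega), fun i hi => hE' _ (by omega), ?_, ?_, fun i => hd _⟩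
  · rw [← LinearMap.ker_eq_bot, Submodule.ker_liftQ_eq_bot']
    exact hηd.linearMap_ker_eq.symm
  · intro x
    refine (hd 0 x).trans ⟨?_, ?_⟩
    · rintro ⟨y, rfl⟩
      exact ⟨Submodule.Quotient.mk y, rfl⟩
    · rintro ⟨y, rfl⟩
      obtain ⟨y, rfl⟩ := Submodule.Quotient.mk_surjective _ y
      exact ⟨y, rfl⟩

end Resolution

/-! ### Ext against cyclic modules; bounding injective and projective dimension -/

namespace ModuleCat

open Abelian

variable {R : Type u} [CommRing R]

theorem subsingleton_ext_of_equiv {X N M : ModuleCat.{u} R} (e : N ≃ₗ[R] M) {i : ℕ}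
    (h : Subsingleton (Ext X N i)) : Subsingleton (Ext X M i) := by
  refine subsingleton_of_forall_eq 0 fun x => ?_
  rw [← x.comp_mk₀_id, ← e.toModuleIso.inv_hom_id, ← Ext.mk₀_comp_mk₀,
    ← Ext.comp_assoc_of_second_deg_zero,
    Subsingleton.elim (x.comp (Ext.mk₀ e.toModuleIso.inv) (add_zero i)) 0, Ext.zero_comp]

theorem subsingleton_ext_of_hasCoresolutionLE {P : ModuleCat.{u} R → Prop} {X : ModuleCat.{u} R}
    (hP : ∀ E, P E → ∀ i, 1 ≤ i → Subsingleton (Ext X E i)) {M : ModuleCat.{u} R} {n : ℕ}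
    (h : HasCoresolutionLE P M n) {i : ℕ} (hi : n < i) : Subsingleton (Ext X M i) := by
  induction n generalizing M i with
  | zero =>
    obtain ⟨N, hN, ⟨e⟩⟩ := h.exists_equiv
    exact subsingleton_ext_of_equiv e.symm (hP N hN i hi)
  | succ n ih =>
    obtain ⟨S, hS, rfl, h2, h3⟩ := h.exists_shortExact
    obtain _ | i := i
    · omega
    have h3 := ih h3 (i := i) (by omega)
    have h2 := hP _ h2 (i + 1) (by omega)
    refine subsingleton_of_forall_eq 0 fun x => ?_
    obtain ⟨y, rfl⟩ := Ext.covariant_sequence_exact₁ X hS x (Subsingleton.elim _ _) rfl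
    rw [Subsingleton.elim y 0, Ext.zero_comp]

theorem exists_colon_exact (J K : Ideal R) (a : R) (hK : ∀ r, r ∈ K ↔ a * r ∈ J) :
    ∃ (f : (R ⧸ K) →ₗ[R] R ⧸ J) (g : (R ⧸ J) →ₗ[R] R ⧸ (J ⊔ Ideal.span {a})),
      (∀ r : R, f (Submodule.Quotient.mk r) = Submodule.Quotient.mk (a * r)) ∧
      Function.Injective f ∧ Function.Exact f g ∧ Function.Surjective g := by
  let f : (R ⧸ K) →ₗ[R] R ⧸ J := Submodule.mapQ K J (LinearMap.mulLeft R a) fun r hr => (hK r).1 hr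
  let g : (R ⧸ J) →ₗ[R] R ⧸ (J ⊔ Ideal.span {a}) := Submodule.factor le_sup_left
  have hf (r : R) : f (Submodule.Quotient.mk r) = Submodule.Quotient.mk (a * r) := rfl
  have hg (r : R) : g (Submodule.Quotient.mk r) = Submodule.Quotient.mk r := rfl
  refine ⟨f, g, hf, ?_, ?_, Submodule.factor_surjective _⟩
  · rw [injective_iff_map_eq_zero]
    intro x hx
    obtain ⟨r, rfl⟩ := Submodule.Quotient.mk_surjective _ x
    rw [hf, Submodule.Quotient.mk_eq_zero] at hx
    exact (Submodule.Quotient.mk_eq_zero _).2 ((hK r).2 hx)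
  · intro x
    obtain ⟨r, rfl⟩ := Submodule.Quotient.mk_surjective _ x
    rw [hg, Submodule.Quotient.mk_eq_zero]
    constructor
    · intro hr
      obtain ⟨j, hj, b, hb, rfl⟩ := Submodule.mem_sup.1 hr
      obtain ⟨c, rfl⟩ := Ideal.mem_span_singleton'.1 hb
      refine ⟨Submodule.Quotient.mk c, ?_⟩
      rw [hf, eq_comm, Submodule.Quotient.eq]
      convert hj using 1
      ring
    · rintro ⟨y, hy⟩
      obtain ⟨s, rfl⟩ := Submodule.Quotient.mk_surjective _ y
      rw [hf, eq_comm, Submodule.Quotient.eq] at hy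
      have : r = (r - a * s) + s * a := by ring
      rw [this]
      exact Submodule.add_mem_sup hy (Ideal.mem_span_singleton'.2 ⟨s, rfl⟩)

/-- Nakayama: a maximal `m` containing the annihilator strictly contains `J`. For `a ∈ m \ J`, `aE =
E` yields an annihilator element congruent to 1 modulo `a`, forcing `1 ∈ m`. -/
theorem subsingleton_of_surjective_smul {E : Type*} [AddCommGroup E] [Module R E]
    [Module.Finite R E] {J : Ideal R} (hmax : ¬ J.IsMaximal) (hJ : ∀ r ∈ J, ∀ x : E, r • x = 0)
    (h : ∀ a ∉ J, ∀ x : E, ∃ y : E, a • y = x) : Subsingleton E := by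
  have hann : Module.annihilator R E = ⊤ := by
    by_contra hne
    obtain ⟨m, hm, hle⟩ := Ideal.exists_le_maximal _ hne
    have hJm : J ≤ m := le_trans (fun r hr => Module.mem_annihilator.2 (hJ r hr)) hle
    obtain ⟨a, ham, haJ⟩ := SetLike.exists_of_lt (lt_of_le_of_ne hJm fun h => hmax (h ▸ hm))
    obtain ⟨r, hr, hr'⟩ := Submodule.exists_sub_one_mem_and_smul_eq_zero_of_fg_of_le_smul
      (M := E) (Ideal.span {a}) ⊤ Module.Finite.fg_top (by
        intro x _
        obtain ⟨y, rfl⟩ := h a haJ x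
        exact Submodule.smul_mem_smul (Ideal.mem_span_singleton_self a) trivial)
    have hrm : r ∈ m := hle (Module.mem_annihilator.2 fun x => hr' x trivial)
    refine hm.ne_top ((Ideal.eq_top_iff_one m).2 ?_)
    have := m.sub_mem hrm ((Ideal.span_singleton_le_iff_mem m).2 ham hr)
    rwa [sub_sub_cancel] at this
  refine subsingleton_of_forall_eq 0 fun x => ?_
  rw [← one_smul R x]
  exact Module.mem_annihilator.1 (hann ▸ Submodule.mem_top) x

/-- Noetherian induction on `J`. If `R/J` has zero divisors, it is an extension of quotients by
larger ideals. Otherwise each `a ∉ J` acts injectively on `R/J` with cokernel `R/(J + a)`, hence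
surjectively on the finite module `Ext^i(R/J, M)`, and Nakayama applies. -/
theorem subsingleton_ext_quotient_of_maximal [IsNoetherianRing R] (M : ModuleCat.{u} R)
    [Module.Finite R M] {n : ℕ}
    (h : ∀ m : Ideal R, m.IsMaximal → ∀ i, n < i → Subsingleton (Ext (of R (R ⧸ m)) M i))
    (J : Ideal R) : ∀ i, n < i → Subsingleton (Ext (of R (R ⧸ J)) M i) := by
  induction J using WellFoundedGT.induction with
  | _ J ih =>
  intro i hi
  by_cases hmax : J.IsMaximal
  · exact h J hmax i hi
  by_cases hreg : ∃ a ∉ J, ∃ b ∉ J, a * b ∈ J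
  · obtain ⟨a, ha, b, hb, hab⟩ := hreg
    let K : Ideal R := Submodule.comap (LinearMap.mulLeft R a) J
    have hK (r : R) : r ∈ K ↔ a * r ∈ J := Iff.rfl
    have hJK : J < K := lt_of_le_of_ne (fun r hr => J.mul_mem_left a hr) fun h => hb (h ▸ hab)
    have hJa : J < J ⊔ Ideal.span {a} := lt_of_le_of_ne le_sup_left fun h =>
      ha (h ▸ Ideal.mem_sup_right (Ideal.mem_span_singleton_self a))
    obtain ⟨f, g, -, hf, hfg, hg⟩ := exists_colon_exact J K a hK
    have hS := shortExact_of_exact hf hfg hg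
    have h1 := ih K hJK i hi
    have h3 := ih _ hJa i hi
    refine subsingleton_of_forall_eq 0 fun x => ?_
    obtain ⟨y, rfl⟩ := Ext.contravariant_sequence_exact₂ hS M x (h1.elim _ _)
    rw [h3.elim y 0, Ext.comp_zero]
  -- Here `J` is prime or the unit ideal; both are covered.
  · refine subsingleton_of_surjective_smul hmax (fun r hr x => ?_) fun a ha x => ?_
    · have hr0 : r • 𝟙 (of R (R ⧸ J)) = 0 := by
        ext
        exact (Submodule.Quotient.mk_eq_zero J).2 (J.mul_mem_right _ hr)
      rw [← Ext.mk₀_id_comp x, ← Ext.smul_comp, ← Ext.mk₀_smul, hr0, Ext.mk₀_zero, Ext.zero_comp]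
    · have hJa : J < J ⊔ Ideal.span {a} := lt_of_le_of_ne le_sup_left fun h =>
        ha (h ▸ Ideal.mem_sup_right (Ideal.mem_span_singleton_self a))
      obtain ⟨f, g, hfa, hf, hfg, hg⟩ := exists_colon_exact J J a fun r =>
        ⟨fun hr => J.mul_mem_left a hr, fun hr => by
          by_contra hr'
          exact hreg ⟨a, ha, r, hr', hr⟩⟩
      have hS := shortExact_of_exact hf hfg hg
      -- The connecting map raises the degree, so the induction must carry all degrees above `n` at
      -- once.
      have h3 := ih _ hJa (1 + i) (by omega)
      have hf' : ofHom f = a • 𝟙 (of R (R ⧸ J)) := by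
        ext
        exact hfa _
      have hy (y : Ext (of R (R ⧸ J)) M i) :
          (Ext.mk₀ (ofHom f)).comp y (zero_add i) = a • y := by
        rw [hf', Ext.mk₀_smul, Ext.smul_comp, Ext.mk₀_id_comp]
      obtain ⟨y, rfl⟩ := Ext.contravariant_sequence_exact₁ hS M x rfl (h3.elim _ _)
      exact ⟨y, (hy y).symm⟩

theorem injective_of_subsingleton_ext_quotient (E : ModuleCat.{u} R)
    (h : ∀ J : Ideal R, Subsingleton (Ext (of R (R ⧸ J)) E 1)) : Injective E := by
  have hE : Module.Baer R E := by
    intro J φ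
    have hS := shortExact_of_exact (K := J) J.subtype_injective (LinearMap.exact_subtype_mkQ J)
      J.mkQ_surjective
    have := h J
    obtain ⟨ψ, hψ⟩ := Ext.contravariant_sequence_exact₁ hS E (Ext.mk₀ (ofHom φ)) (add_zero 1)
      (this.elim _ _)
    obtain ⟨ψ, rfl⟩ := Ext.homEquiv₀.symm.surjective ψ
    have hψ : ofHom J.subtype ≫ ψ = ofHom φ := Ext.homEquiv₀.symm.injective (by simpa using hψ)
    refine ⟨ψ.hom, fun x hx => ?_⟩
    exact LinearMap.congr_fun (congrArg Hom.hom hψ) ⟨x, hx⟩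
  have := hE.injective
  exact Module.injective_object_of_injective_module R E

theorem hasInjectiveDimensionLE_of_subsingleton_ext_quotient (N : ModuleCat.{u} R) (n : ℕ)
    (h : ∀ J : Ideal R, Subsingleton (Ext (of R (R ⧸ J)) N (n + 1))) :
    HasInjectiveDimensionLE N n := by
  induction n generalizing N with
  | zero =>
    have := injective_of_subsingleton_ext_quotient N h
    exact injective_iff_hasInjectiveDimensionLT_one.1 this
  | succ n ih =>
    obtain ⟨p⟩ := EnoughInjectives.presentation N
    have hS : (ShortComplex.mk _ _ (Limits.cokernel.condition p.f)).ShortExact :=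
      { exact := ShortComplex.exact_cokernel p.f }
    refine (hS.hasInjectiveDimensionLT_X₃_iff n p.injective).1 (ih _ fun J => ?_)
    have := h J
    have := p.injective
    refine subsingleton_of_forall_eq 0 fun x => ?_
    obtain ⟨y, rfl⟩ := Ext.covariant_sequence_exact₃ _ hS x rfl (Subsingleton.elim _ _)
    rw [Ext.eq_zero_of_injective y, Ext.zero_comp]

theorem hasCoresolutionLE_of_hasInjectiveDimensionLE (N : ModuleCat.{u} R) (n : ℕ)
    (h : HasInjectiveDimensionLE N n) : HasCoresolutionLE (fun E => Injective E) N n := by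
  induction n generalizing N with
  | zero => exact .of_mem (injective_iff_hasInjectiveDimensionLT_one.2 h)
  | succ n ih =>
    obtain ⟨p⟩ := EnoughInjectives.presentation N
    have hp : Function.Injective p.f.hom := (mono_iff_injective p.f).1 p.mono
    have he := LinearMap.exact_map_mkQ_range p.f.hom
    have hs := (LinearMap.range p.f.hom).mkQ_surjective
    have hS := shortExact_of_exact hp he hs
    exact HasCoresolutionLE.succ (C := of R (_ ⧸ LinearMap.range p.f.hom)) p.injective hp he hs
      (ih _ ((hS.hasInjectiveDimensionLT_X₃_iff n p.injective).2 h))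

theorem hasProjectiveDimensionLE_of_subsingleton_ext [IsNoetherianRing R] (M : ModuleCat.{u} R)
    [Module.Finite R M] (n : ℕ)
    (h : ∀ N : ModuleCat.{u} R, Module.Finite R N → Subsingleton (Ext M N (n + 1))) :
    HasProjectiveDimensionLE M n := by
  induction n generalizing M with
  | zero =>
    obtain ⟨F, _, _, _, _, f, hf⟩ := Module.exists_finite_presentation R M
    have hS := LinearMap.shortExact_shortComplexKer hf
    -- The kernel is finite by Noetherianity, so it is an admissible `N` and the identity of `M`
    -- lifts to `F`.
    have := h (of R (LinearMap.ker f)) inferInstance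
    obtain ⟨s, hs⟩ := Ext.covariant_sequence_exact₃ M hS (Ext.mk₀ (𝟙 M)) (zero_add 1)
      (Subsingleton.elim _ _)
    obtain ⟨s, rfl⟩ := Ext.homEquiv₀.symm.surjective s
    have hs : s ≫ ofHom f = 𝟙 M := Ext.homEquiv₀.symm.injective (by simpa using hs)
    have := Module.Projective.of_split s.hom f (congrArg Hom.hom hs)
    exact projective_iff_hasProjectiveDimensionLT_one.1
      ((IsProjective.iff_projective (R := R) M).1 this)
  | succ n ih =>
    obtain ⟨F, _, _, _, _, f, hf⟩ := Module.exists_finite_presentation R M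
    have hS := LinearMap.shortExact_shortComplexKer hf
    have hF : Projective (of R F) := (IsProjective.iff_projective (R := R) F).1 inferInstance
    have : Module.Finite R (LinearMap.ker f) := inferInstance
    refine (hS.hasProjectiveDimensionLT_X₃_iff n hF).2 (ih (of R (LinearMap.ker f)) fun N hN => ?_)
    have := h N hN
    refine subsingleton_of_forall_eq 0 fun x => ?_
    obtain ⟨y, rfl⟩ := Ext.contravariant_sequence_exact₁ hS N x (add_comm _ _)
      (Subsingleton.elim _ _)
    rw [@Ext.eq_zero_of_projective _ _ _ _ _ _ _ _ y, Ext.comp_zero]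

end ModuleCat

/-! ### From Tor against residue fields to projective dimension -/

namespace ModuleCat

open Abelian TensorProduct

variable {R : Type u} [CommRing R]

/-- The same induction in the second variable. Surjectivity of `a` now needs only `Ext^i(M, R/(J +
a)) = 0`, so a single degree suffices. -/
theorem subsingleton_ext_to_quotient_of_maximal [IsNoetherianRing R] (M : ModuleCat.{u} R)
    [Module.Finite R M] {i : ℕ}
    (h : ∀ m : Ideal R, m.IsMaximal → Subsingleton (Ext M (of R (R ⧸ m)) i))
    (J : Ideal R) : Subsingleton (Ext M (of R (R ⧸ J)) i) := by
  induction J using WellFoundedGT.induction with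
  | _ J ih =>
  by_cases hmax : J.IsMaximal
  · exact h J hmax
  by_cases hreg : ∃ a ∉ J, ∃ b ∉ J, a * b ∈ J
  · obtain ⟨a, ha, b, hb, hab⟩ := hreg
    let K : Ideal R := Submodule.comap (LinearMap.mulLeft R a) J
    have hK (r : R) : r ∈ K ↔ a * r ∈ J := Iff.rfl
    have hJK : J < K := lt_of_le_of_ne (fun r hr => J.mul_mem_left a hr) fun h => hb (h ▸ hab)
    have hJa : J < J ⊔ Ideal.span {a} := lt_of_le_of_ne le_sup_left fun h =>
      ha (h ▸ Ideal.mem_sup_right (Ideal.mem_span_singleton_self a))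
    obtain ⟨f, g, -, hf, hfg, hg⟩ := exists_colon_exact J K a hK
    have hS := shortExact_of_exact hf hfg hg
    have h1 := ih K hJK
    have h3 := ih _ hJa
    refine subsingleton_of_forall_eq 0 fun x => ?_
    obtain ⟨y, rfl⟩ := Ext.covariant_sequence_exact₂ M hS x (h3.elim _ _)
    rw [h1.elim y 0, Ext.zero_comp]
  · refine subsingleton_of_surjective_smul hmax (fun r hr x => ?_) fun a ha x => ?_
    · have hr0 : r • 𝟙 (of R (R ⧸ J)) = 0 := by
        ext
        exact (Submodule.Quotient.mk_eq_zero J).2 (J.mul_mem_right _ hr)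
      rw [← Ext.comp_mk₀_id x, ← Ext.comp_smul, ← Ext.mk₀_smul, hr0, Ext.mk₀_zero, Ext.comp_zero]
    · have hJa : J < J ⊔ Ideal.span {a} := lt_of_le_of_ne le_sup_left fun h =>
        ha (h ▸ Ideal.mem_sup_right (Ideal.mem_span_singleton_self a))
      obtain ⟨f, g, hfa, hf, hfg, hg⟩ := exists_colon_exact J J a fun r =>
        ⟨fun hr => J.mul_mem_left a hr, fun hr => by
          by_contra hr'
          exact hreg ⟨a, ha, r, hr', hr⟩⟩
      have hS := shortExact_of_exact hf hfg hg
      have h3 := ih _ hJa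
      have hf' : ofHom f = a • 𝟙 (of R (R ⧸ J)) := by
        ext
        exact hfa _
      have hy (y : Ext M (of R (R ⧸ J)) i) :
          y.comp (Ext.mk₀ (ofHom f)) (add_zero i) = a • y := by
        rw [hf', Ext.mk₀_smul, Ext.comp_smul, Ext.comp_mk₀_id]
      obtain ⟨y, rfl⟩ := Ext.covariant_sequence_exact₂ M hS x (h3.elim _ _)
      exact ⟨y, (hy y).symm⟩

theorem subsingleton_ext_of_maximal [IsNoetherianRing R] (M : ModuleCat.{u} R)
    [Module.Finite R M] {i : ℕ}
    (h : ∀ m : Ideal R, m.IsMaximal → Subsingleton (Ext M (of R (R ⧸ m)) i))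
    (N : Type u) [AddCommGroup N] [Module R N] (hN : Module.Finite R N) :
    Subsingleton (Ext M (of R N) i) := by
  induction hN using IsNoetherianRing.induction_on_isQuotientEquivQuotientPrime R with
  | subsingleton N =>
    refine subsingleton_of_forall_eq 0 fun x => ?_
    have : 𝟙 (of R N) = 0 := by
      ext y
      exact Subsingleton.elim _ _
    rw [← Ext.comp_mk₀_id x, this, Ext.mk₀_zero, Ext.comp_zero]
  | quotient N p e =>
    exact subsingleton_ext_of_equiv (N := of R (R ⧸ p.1)) (M := of R N) e.symm
      (subsingleton_ext_to_quotient_of_maximal M h p.1)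
  | exact N₁ N₂ N₃ f g hf hg hfg h1 h3 =>
    have hS := shortExact_of_exact hf hfg hg
    refine subsingleton_of_forall_eq 0 fun x => ?_
    obtain ⟨y, rfl⟩ := Ext.covariant_sequence_exact₂ M hS x (h3.elim _ _)
    rw [h1.elim y 0, Ext.zero_comp]

/-- Maps to `R/m` factor through base change to the field `R/m`, where the injection `f` becomes
split. -/
theorem exists_extension_of_lTensor_injective {K F : Type u} [AddCommGroup K] [Module R K]
    [AddCommGroup F] [Module R F] {m : Ideal R} (hm : m.IsMaximal) {f : K →ₗ[R] F}
    (hf : Function.Injective (f.lTensor (R ⧸ m))) (φ : K →ₗ[R] R ⧸ m) :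
    ∃ ψ : F →ₗ[R] R ⧸ m, ψ ∘ₗ f = φ := by
  let := Ideal.Quotient.field m
  obtain ⟨s, hs⟩ := (f.baseChange (R ⧸ m)).exists_leftInverse_of_injective
    (LinearMap.ker_eq_bot.2 hf)
  refine ⟨((φ.liftBaseChange (R ⧸ m)) ∘ₗ s).restrictScalars R ∘ₗ
    TensorProduct.mk R (R ⧸ m) F 1, ?_⟩
  ext x
  have := LinearMap.congr_fun hs ((1 : R ⧸ m) ⊗ₜ x)
  simp only [LinearMap.comp_apply, LinearMap.baseChange_tmul, LinearMap.id_apply] at this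
  simp [this]

/-- Every class in `Ext^1(M, R/m)` comes from a map on the kernel of a free cover; once that map
extends to the cover, the class dies. -/
theorem subsingleton_ext_one_of_torVanishes {m : Ideal R} (hm : m.IsMaximal) (M : ModuleCat.{u} R)
    (h : TorVanishes R (R ⧸ m) M 1) : Subsingleton (Ext M (of R (R ⧸ m)) 1) := by
  let p : (M →₀ R) →ₗ[R] M := Finsupp.linearCombination R id
  have hp : Function.Surjective p := Finsupp.linearCombination_id_surjective R M
  have hS := LinearMap.shortExact_shortComplexKer hp
  have hF : Projective (of R (M →₀ R)) :=
    (IsProjective.iff_projective (R := R) (M →₀ R)).1 inferInstance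
  refine subsingleton_of_forall_eq 0 fun x => ?_
  obtain ⟨y, rfl⟩ := Ext.contravariant_sequence_exact₃ hS _ x
    (@Ext.eq_zero_of_projective _ _ _ _ _ _ _ _ _) (add_zero 1)
  obtain ⟨φ, rfl⟩ := Ext.homEquiv₀.symm.surjective y
  obtain ⟨ψ, hψ⟩ := exists_extension_of_lTensor_injective hm
    ((torVanishes_one_iff_ker (R ⧸ m) hp).1 h) φ.hom
  have : φ = p.shortComplexKer.f ≫ ofHom ψ := hom_ext hψ.symm
  rw [this, Ext.homEquiv₀_symm_apply, ← Ext.mk₀_comp_mk₀]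
  exact hS.extClass_comp_assoc _

theorem hasProjectiveDimensionLE_of_torVanishes [IsNoetherianRing R] (M : ModuleCat.{u} R)
    [Module.Finite R M] (n : ℕ)
    (h : ∀ m : Ideal R, m.IsMaximal → TorVanishes R (R ⧸ m) M (n + 1)) :
    HasProjectiveDimensionLE M n := by
  induction n generalizing M with
  | zero =>
    exact hasProjectiveDimensionLE_of_subsingleton_ext M 0 fun N hN =>
      subsingleton_ext_of_maximal M
        (fun m hm => subsingleton_ext_one_of_torVanishes hm M (h m hm)) N hN
  | succ n ih =>
    obtain ⟨F, _, _, _, _, f, hf⟩ := Module.exists_finite_presentation R M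
    have hS := LinearMap.shortExact_shortComplexKer hf
    have hF : Projective (of R F) := (IsProjective.iff_projective (R := R) F).1 inferInstance
    have : Module.Finite R (LinearMap.ker f) := inferInstance
    exact (hS.hasProjectiveDimensionLT_X₃_iff n hF).2 (ih (of R (LinearMap.ker f)) fun m hm =>
      (torVanishes_succ_iff_ker (R ⧸ m) hf n).1 (h m hm))

theorem torVanishes_of_hasResolutionLE {P : ModuleCat.{u} R → Prop} {X : Type u} [AddCommGroup X]
    [Module R X] (hP : ∀ F : ModuleCat.{u} R, P F → ∀ i, TorVanishes R X F (i + 1))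
    {M : ModuleCat.{u} R} {n : ℕ} (h : HasResolutionLE P M n) (i : ℕ) :
    TorVanishes R X M (n + i + 1) := by
  induction n generalizing M i with
  | zero =>
    obtain ⟨N, hN, ⟨e⟩⟩ := h.exists_equiv
    exact (hP N hN _).of_equiv e
  | succ n ih =>
    obtain ⟨S, hS, rfl, h2, h3⟩ := h.exists_shortExact
    have := torVanishes_succ_of_exact X hS.moduleCat_injective_f
      ((ShortComplex.ShortExact.moduleCat_exact_iff_function_exact S).1 hS.exact)
      hS.moduleCat_surjective_g (hP _ h2) (ih h3 i)
    rwa [show n + 1 + i + 1 = n + i + 2 by omega]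

theorem hasResolutionLE_of_hasProjectiveDimensionLE (M : ModuleCat.{u} R) (n : ℕ)
    (h : HasProjectiveDimensionLE M n) : HasResolutionLE (fun F => Projective F) M n := by
  induction n generalizing M with
  | zero => exact .of_mem (projective_iff_hasProjectiveDimensionLT_one.2 h)
  | succ n ih =>
    let p : (M →₀ R) →ₗ[R] M := Finsupp.linearCombination R id
    have hp : Function.Surjective p := Finsupp.linearCombination_id_surjective R M
    have hS := LinearMap.shortExact_shortComplexKer hp
    have hF : Projective (of R (M →₀ R)) :=
      (IsProjective.iff_projective (R := R) (M →₀ R)).1 inferInstance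
    exact HasResolutionLE.succ (K := of R (LinearMap.ker p)) (N := of R (M →₀ R)) hF
      (LinearMap.ker p).subtype_injective (LinearMap.exact_subtype_ker_map p) hp
      (ih _ ((hS.hasProjectiveDimensionLT_X₃_iff n hF).1 h))

end ModuleCat

/-! ### Comparison of dimensions and the global dimension -/

section Main

open ModuleCat

variable {R : Type u} [CommRing R] (I : Ideal R)

theorem IsRelFlat.of_flat (F : ModuleCat.{u} R) (hF : Module.Flat R F) : IsRelFlat I F := by
  rintro J - i hi
  obtain ⟨i, rfl⟩ := Nat.exists_eq_add_of_le' hi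
  exact TorVanishes.of_flat (R ⧸ J) F i

theorem IsRelInjective.of_injective (E : ModuleCat.{u} R) (hE : Injective E) :
    IsRelInjective I E := by
  rintro J - i hi
  obtain ⟨i, rfl⟩ := Nat.exists_eq_add_of_le' hi
  exact subsingleton_of_forall_eq 0 fun x => Abelian.Ext.eq_zero_of_injective x

theorem flat_of_projective_object (F : ModuleCat.{u} R) (hF : Projective F) : Module.Flat R F :=
  have := (IsProjective.iff_projective (R := R) F).2 hF
  inferInstance

theorem resolutionDim_mono {P Q : ModuleCat.{u} R → Prop} (hPQ : ∀ N, P N → Q N)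
    (M : ModuleCat.{u} R) : resolutionDim Q M ≤ resolutionDim P M :=
  WithBot.le_of_forall_natCast
    (fun h => resolutionDim_eq_bot_iff.2 (resolutionDim_eq_bot_iff.1 h)) fun n h => by
      rw [resolutionDim_le_iff] at h ⊢
      exact h.imp_right fun ⟨k, hk, h⟩ => ⟨k, hk, h.mono hPQ⟩

theorem flatDim_le_projectiveDimension (M : ModuleCat.{u} R) :
    flatDim M ≤ projectiveDimension M := by
  refine WithBot.le_of_forall_natCast (fun h => ?_) fun n h => ?_
  · rw [projectiveDimension_eq_bot_iff, isZero_iff_subsingleton] at h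
    exact resolutionDim_eq_bot_iff.2 h
  · rw [projectiveDimension_le_iff] at h
    exact resolutionDim_le_iff.2 (Or.inr ⟨n, le_rfl,
      (hasResolutionLE_of_hasProjectiveDimensionLE M n h).mono flat_of_projective_object⟩)

theorem relFlatDim_le_flatDim (M : ModuleCat.{u} R) : relFlatDim I M ≤ flatDim M :=
  resolutionDim_mono (IsRelFlat.of_flat I) M

theorem relInjectiveDim_le_injectiveDimension (M : ModuleCat.{u} R) :
    relInjectiveDim I M ≤ injectiveDimension M := by
  refine WithBot.le_of_forall_natCast (fun h => ?_) fun n h => ?_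
  · rw [injectiveDimension_eq_bot_iff, isZero_iff_subsingleton] at h
    exact coresolutionDim_eq_bot_iff.2 h
  · rw [injectiveDimension_le_iff] at h
    exact coresolutionDim_le_iff.2 (Or.inr ⟨n, le_rfl,
      (hasCoresolutionLE_of_hasInjectiveDimensionLE M n h).mono (IsRelInjective.of_injective I)⟩)

variable {I}

/-- Makes every maximal ideal an admissible `J` in the relative notions. -/
theorem le_of_isMaximal_of_le_jacobson (hI : I ≤ Ideal.jacobson (⊥ : Ideal R)) {m : Ideal R}
    (hm : m.IsMaximal) : ∃ t : ℕ, I ^ t ≤ m :=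
  ⟨1, (pow_one I).trans_le (hI.trans (sInf_le ⟨bot_le, hm⟩))⟩

theorem projectiveDimension_le_relFlatDim [IsNoetherianRing R]
    (hI : I ≤ Ideal.jacobson (⊥ : Ideal R))
    (M : ModuleCat.{u} R) [Module.Finite R M] : projectiveDimension M ≤ relFlatDim I M := by
  refine WithBot.le_of_forall_natCast (fun h => ?_) fun n h => ?_
  · rw [projectiveDimension_eq_bot_iff, isZero_iff_subsingleton]
    exact resolutionDim_eq_bot_iff.1 h
  · obtain h | ⟨k, hk, h⟩ := resolutionDim_le_iff.1 h
    · rw [← isZero_iff_subsingleton, ← projectiveDimension_eq_bot_iff] at h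
      exact h.trans_le bot_le
    · refine ((projectiveDimension_le_iff M k).2 ?_).trans (by exact_mod_cast hk)
      refine hasProjectiveDimensionLE_of_torVanishes M k fun m hm => ?_
      exact torVanishes_of_hasResolutionLE (fun F hF i =>
        hF m (le_of_isMaximal_of_le_jacobson hI hm) (i + 1) (by omega)) h 0

theorem injectiveDimension_le_relInjectiveDim [IsNoetherianRing R]
    (hI : I ≤ Ideal.jacobson (⊥ : Ideal R))
    (M : ModuleCat.{u} R) [Module.Finite R M] : injectiveDimension M ≤ relInjectiveDim I M := by
  refine WithBot.le_of_forall_natCast (fun h => ?_) fun n h => ?_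
  · rw [injectiveDimension_eq_bot_iff, isZero_iff_subsingleton]
    exact coresolutionDim_eq_bot_iff.1 h
  · obtain h | ⟨k, hk, h⟩ := coresolutionDim_le_iff.1 h
    · rw [← isZero_iff_subsingleton, ← injectiveDimension_eq_bot_iff] at h
      exact h.trans_le bot_le
    · refine ((injectiveDimension_le_iff M k).2 ?_).trans (by exact_mod_cast hk)
      refine hasInjectiveDimensionLE_of_subsingleton_ext_quotient M k fun J => ?_
      refine subsingleton_ext_quotient_of_maximal M (fun m hm i hi => ?_) J (k + 1) k.lt_succ_self
      exact subsingleton_ext_of_hasCoresolutionLE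
        (fun E hE => hE m (le_of_isMaximal_of_le_jacobson hI hm)) h hi

/-- Auslander's argument: bounds on the cyclic modules `R/J` bound every injective dimension by
Baer, and hence every projective dimension. -/
theorem globalDim_le_of_forall_finite {c : WithBot ℕ∞}
    (h : ∀ M : ModuleCat.{u} R, Module.Finite R M → projectiveDimension M ≤ c) :
    globalDim R ≤ c := by
  refine iSup_le fun M => WithBot.le_of_forall_natCast (fun hc => ?_) fun n hn => ?_
  -- If `c = ⊥`, then `R` itself is zero and so is every module.
  · have := h (of R R) inferInstance
    rw [hc, le_bot_iff, projectiveDimension_eq_bot_iff, isZero_iff_subsingleton] at this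
    have : Subsingleton R := this
    rw [projectiveDimension_eq_bot_iff, isZero_iff_subsingleton]
    exact Module.subsingleton R M
  · rw [projectiveDimension_le_iff]
    refine hasProjectiveDimensionLT_of_enoughInjectives M (n + 1) fun N => ?_
    have hN : HasInjectiveDimensionLE N n :=
      hasInjectiveDimensionLE_of_subsingleton_ext_quotient N n fun J => by
        have := (projectiveDimension_le_iff _ n).1 ((h (of R (R ⧸ J)) inferInstance).trans hn)
        exact HasProjectiveDimensionLT.subsingleton _ (n + 1) (n + 1) le_rfl N
    exact HasInjectiveDimensionLT.subsingleton N (n + 1) (n + 1) le_rfl M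

theorem injectiveDimension_le_globalDim (M : ModuleCat.{u} R) :
    injectiveDimension M ≤ globalDim R := by
  refine WithBot.le_of_forall_natCast (fun hc => ?_) fun n hn => ?_
  · have := (le_iSup projectiveDimension M).trans hc.le
    rw [le_bot_iff, projectiveDimension_eq_bot_iff] at this
    rwa [injectiveDimension_eq_bot_iff]
  · rw [injectiveDimension_le_iff]
    refine hasInjectiveDimensionLT_of_enoughProjectives M (n + 1) fun N => ?_
    have := (projectiveDimension_le_iff N n).1 ((le_iSup projectiveDimension N).trans hn)
    exact HasProjectiveDimensionLT.subsingleton N (n + 1) (n + 1) le_rfl M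

theorem globalDim_le_of_forall_finite_injectiveDimension [IsNoetherianRing R]
    {c : WithBot ℕ∞}
    (h : ∀ M : ModuleCat.{u} R, Module.Finite R M → injectiveDimension M ≤ c) :
    globalDim R ≤ c := by
  refine globalDim_le_of_forall_finite fun M hM =>
    WithBot.le_of_forall_natCast (fun hc => ?_) fun n hn => ?_
  · have := (h M hM).trans hc.le
    rw [le_bot_iff, injectiveDimension_eq_bot_iff] at this
    rwa [projectiveDimension_eq_bot_iff]
  · rw [projectiveDimension_le_iff]
    refine hasProjectiveDimensionLE_of_subsingleton_ext M n fun N hN => ?_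
    have := (injectiveDimension_le_iff N n).1 ((h N hN).trans hn)
    exact HasInjectiveDimensionLT.subsingleton N (n + 1) (n + 1) le_rfl M

end Main

theorem mainTheorem9 {R : Type u} [CommRing R] [IsNoetherianRing R] (I : Ideal R)
    (hI : I ≤ Ideal.jacobson (⊥ : Ideal R)) :
    (∀ M : ModuleCat.{u} R, Module.Finite R M →
      relFlatDim I M = flatDim M ∧ relInjectiveDim I M = injectiveDimension M) ∧
    globalDim R = (⨆ M : ModuleCat.{u} R, relFlatDim I M) ∧
    globalDim R = (⨆ M : ModuleCat.{u} R, relInjectiveDim I M) := by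
  refine ⟨fun M _ => ⟨?_, ?_⟩, ?_, ?_⟩
  · exact (relFlatDim_le_flatDim I M).antisymm
      ((flatDim_le_projectiveDimension M).trans (projectiveDimension_le_relFlatDim hI M))
  · exact (relInjectiveDim_le_injectiveDimension I M).antisymm
      (injectiveDimension_le_relInjectiveDim hI M)
  · refine le_antisymm (globalDim_le_of_forall_finite fun M _ => ?_) (iSup_mono fun M => ?_)
    · exact (projectiveDimension_le_relFlatDim hI M).trans (le_iSup (relFlatDim I) M)
    · exact (relFlatDim_le_flatDim I M).trans (flatDim_le_projectiveDimension M)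
  · refine le_antisymm (globalDim_le_of_forall_finite_injectiveDimension fun M _ => ?_)
      (iSup_le fun M => ?_)
    · exact (injectiveDimension_le_relInjectiveDim hI M).trans (le_iSup (relInjectiveDim I) M)
    · exact (relInjectiveDim_le_injectiveDimension I M).trans (injectiveDimension_le_globalDim M)
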